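/- Let $(\gamma_n)_{n\ge 0}$ be nonnegative measurable functions on $(0,\infty)$, write $\|\gamma_n\|_1=\int_0^\infty\gamma_n(t)\,dt$, and let $(N^n)_{n\ge0}$ be non-explosive simple point processes on $(0,\infty)$ without common jumps (in particular with no points in $(-\infty,0]$) such that $N^0$ is a Poisson process with intensity $\gamma_0(t)$ and, for every $n\ge1$, conditionally on $N^0,\dots,N^{n-1}$, the process $N^n$ is an inhomogeneous Poisson process with intensity $\lambda^n_t=\int_{(0,t)}\gamma_n(t-s)\,N^{n-1}(ds)$. Let $N=\sum_{n\ge0}N^n$ be the Hawkes process with exciting functions $(\gamma_n)_{n\ge0}$ and empty history, and let $N_t=N(0,t]$. Assume that (i) $\overline\gamma_0:=\lim_{t\to\infty}\frac1t\int_0^t\gamma_0(s)\,ds$ exists and is finite; (ii) $\sup_{n\ge1}\|\gamma_n\|_1<1$. For $\theta\in\mathbb R$ and $M\in\mathbb N$ let $f_M(\theta)$ be the last term of the recursion $$f_0(\theta)=\theta,\qquad f_n(\theta)=\theta+\|\gamma_{M+1-n}\|_1\bigl(e^{f_{n-1}(\theta)}-1\bigr),\quad 1\le n\le M$$ (the recursion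 itself depends on $M$). Then for every $\theta\in\mathbb R$ the limit $f_\infty(\theta):=\lim_{M\to\infty}f_M(\theta)$ exists on the extended real line, and if $\overline\gamma_0>0$ or $f_\infty(\theta)<\infty$, then the limit $$\Gamma(\theta):=\lim_{t\to\infty}\frac1t\log\mathbb E\bigl[e^{\theta N_t}\bigr]$$ exists on the extended real line and $$\Gamma(\theta)=\overline\gamma_0\bigl(e^{f_\infty(\theta)}-1\bigr),$$ with $e^{+\infty}=+\infty$. -/

import Mathlib

open MeasureTheory ProbabilityTheory Set Filter Topology
open scoped ENNReal NNReal

/-- A locally finite counting measure on the line that is carried by `(0, ∞)`: every bounded Borel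
set has a finite integer mass, and there is no mass on `(-∞, 0]` (empty history). -/
def IsPointMeasure (ν : Measure ℝ) : Prop :=
  (∀ A : Set ℝ, MeasurableSet A → Bornology.IsBounded A → ∃ k : ℕ, ν A = k) ∧ ν (Iic 0) = 0

/-- The probability that a Poisson variable with mean `m ∈ [0, ∞]` equals `k ∈ ℕ`; a Poisson
variable with infinite mean is almost surely infinite. -/
noncomputable def poissonProb (m : ℝ≥0∞) (k : ℕ) : ℝ :=
  if m = ⊤ then 0 else (poissonMeasure m.toNNReal).real {k}

/-- Conditionally on the `σ`-algebra `G`, the point process `X` is a Poisson process with (random)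
intensity measure `Λ`: the numbers of points in pairwise disjoint Borel sets `A i` are conditionally
independent, with conditional Poisson laws of means `Λ (A i)`. -/
def IsPoissonGiven {Ω : Type*} [MeasurableSpace Ω] (μ : Measure Ω) (G : MeasurableSpace Ω)
    (X : Ω → Measure ℝ) (Λ : Ω → Measure ℝ) : Prop :=
  ∀ (d : ℕ) (A : Fin d → Set ℝ) (k : Fin d → ℕ), (∀ i, MeasurableSet (A i)) →
    Pairwise (fun i j => Disjoint (A i) (A j)) →
    μ⟦{ω | ∀ i, X ω (A i) = (k i : ℝ≥0∞)} | G⟧ =ᵐ[μ]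
      fun ω => ∏ i, poissonProb (Λ ω (A i)) (k i)

/-- The intensity at time `t` of the `n`-th generation: `γ₀(t)` for `n = 0`, and
`∫_{(0,t)} γₙ(t - u) Nⁿ⁻¹(du)` for `n ≥ 1`. -/
noncomputable def generationIntensity {Ω : Type*} (γ : ℕ → ℝ → ℝ≥0) (N : ℕ → Ω → Measure ℝ) :
    ℕ → Ω → ℝ → ℝ≥0∞
  | 0, _, t => γ 0 t
  | n + 1, ω, t => ∫⁻ u in Ioo 0 t, (γ (n + 1) (t - u) : ℝ≥0∞) ∂(N n ω)

/-- `N 0, N 1, N 2, …` are the successive generations of a Hawkes process with exciting functions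
`γ 0, γ 1, γ 2, …` and empty history. -/
structure IsHawkesGenerations {Ω : Type*} [MeasurableSpace Ω] (μ : Measure Ω)
    (γ : ℕ → ℝ → ℝ≥0) (N : ℕ → Ω → Measure ℝ) : Prop where
  /-- each generation is a random measure -/
  measurable : ∀ n, Measurable (N n)
  /-- each generation is a non-explosive point process on `(0, ∞)` -/
  isPointMeasure : ∀ n ω, IsPointMeasure (N n ω)
  /-- each generation is simple -/
  simple : ∀ n, ∀ᵐ ω ∂μ, ∀ x, N n ω {x} ≤ 1
  /-- different generations have no common jumps -/
  no_common_jumps : ∀ m n, m ≠ n → ∀ᵐ ω ∂μ, ∀ x, N m ω {x} = 0 ∨ N n ω {x} = 0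
  /-- given the earlier generations (nothing, for `n = 0`), the `n`-th generation is an
  inhomogeneous Poisson process with intensity `generationIntensity γ N n` on `(0, ∞)` -/
  poisson : ∀ n, IsPoissonGiven μ (⨆ (k : ℕ) (_ : k < n), MeasurableSpace.comap (N k) inferInstance)
    (N n) (fun ω => (volume.restrict (Ioi 0)).withDensity (generationIntensity γ N n ω))

/-- `N_t = N(0,t]` for the Hawkes process `N = ∑ₙ Nⁿ`. -/
noncomputable def hawkesCount {Ω : Type*} (N : ℕ → Ω → Measure ℝ) (t : ℝ) (ω : Ω) : ℝ≥0∞ :=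
  Measure.sum (fun n => N n ω) (Ioc 0 t)

/-- The `L¹` norm `∫₀^∞ g(t) dt` of a nonnegative function on `(0, ∞)`. -/
noncomputable def l1Norm (g : ℝ → ℝ≥0) : ℝ≥0∞ := ∫⁻ t in Ioi 0, (g t : ℝ≥0∞)

/-- `ρ`, the supremum of the `L¹` norms of the exciting functions `γₙ` over `n ≥ 1`. -/
noncomputable def offspringMean (γ : ℕ → ℝ → ℝ≥0) : ℝ≥0∞ :=
  ⨆ (n : ℕ) (_ : 1 ≤ n), l1Norm (γ n)

/-- `hawkesF γ θ M n` is `fₙ(θ)`, `0 ≤ n ≤ M`, in the recursion with parameter `M`; the quantity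
called `f_M(θ)` is `hawkesF γ θ M M`. -/
noncomputable def hawkesF (γ : ℕ → ℝ → ℝ≥0) (θ : ℝ) (M : ℕ) : ℕ → ℝ
  | 0 => θ
  | n + 1 => θ + (l1Norm (γ (M + 1 - (n + 1)))).toReal * (Real.exp (hawkesF γ θ M n) - 1)

/-! Write `θ = ± a` with `a ≥ 0` and carry only absolute values, in `[0, ∞]`: the Boolean `b`
records the sign, and `expIncrement b x` is `|e^{±x} - 1|`. Both signs then share the same
increasing quantities, and no integrability has to be checked before limits are taken.

The Laplace functional of a conditional Poisson process (`IsPoissonGiven.lintegral_mul_signedExp`)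
replaces an integral of `g` against a generation by an integral of `expIncrement b ∘ g` against its
intensity, which is itself an integral against the preceding generation. Integrating out the
generations from the last to the first gives the exact formula `lintegral_signedExp_hawkesCount`:
the log-moment of `N_t` is, up to sign, the supremum over `M` of `∫₀ᵗ γ₀(s) |e^{±K_M(t-s)} - 1| ds`,
where `K_M` is the cluster exponent.

As the age grows, `K_M` increases to `totalExponent`, which is `|f_M(θ)|`; this increases with `M`,
so `f_∞` exists. Averaging against `γ₀` gives the limit in `tendsto_iSup_setLIntegral_div`: the
upper bound is immediate, and the lower bound discards the immigrants of the last `T` units of time.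
-/

/-! ### Exponentials with a sign, in `[0, ∞]`. -/

/-- `e ^ x` if `b` is `true`, and `e ^ (-x)` if `b` is `false`. -/
noncomputable def signedExp : Bool → ℝ≥0∞ → ℝ≥0∞
  | true, x => EReal.exp (x : EReal)
  | false, x => EReal.exp (-(x : EReal))

/-- The distance from `e ^ (± x)` to `1`: it is `e ^ x - 1` if `b` is `true`, and `1 - e ^ (-x)`
if `b` is `false`. -/
noncomputable def expIncrement : Bool → ℝ≥0∞ → ℝ≥0∞
  | true, x => EReal.exp (x : EReal) - 1
  | false, x => 1 - EReal.exp (-(x : EReal))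

/-- The sign `± 1` encoded by `b`. -/
def boolSign : Bool → ℝ
  | true => 1
  | false => -1

lemma signedExp_add (b : Bool) (x y : ℝ≥0∞) :
    signedExp b (x + y) = signedExp b x * signedExp b y := by
  cases b
  · simp only [signedExp, ← EReal.exp_add]
    rw [EReal.coe_ennreal_add, EReal.neg_add (Or.inl (EReal.coe_ennreal_ne_bot x))
      (Or.inr (EReal.coe_ennreal_ne_bot y)), sub_eq_add_neg]
  · simp only [signedExp, ← EReal.exp_add, EReal.coe_ennreal_add]

@[simp] lemma signedExp_zero (b : Bool) : signedExp b 0 = 1 := by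
  cases b <;> simp [signedExp]

lemma signedExp_sum {ι : Type*} (b : Bool) (s : Finset ι) (f : ι → ℝ≥0∞) :
    signedExp b (∑ i ∈ s, f i) = ∏ i ∈ s, signedExp b (f i) := by
  classical
  induction s using Finset.induction_on with
  | empty => simp
  | insert i s hi ih => rw [Finset.sum_insert hi, Finset.prod_insert hi, signedExp_add, ih]

lemma signedExp_mul_natCast (b : Bool) (x : ℝ≥0∞) (k : ℕ) :
    signedExp b (x * k) = signedExp b x ^ k := by
  have := signedExp_sum b (Finset.range k) (fun _ => x)
  simpa [mul_comm] using this

lemma continuous_signedExp (b : Bool) : Continuous (signedExp b) := by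
  cases b
  · exact ENNReal.continuous_exp.comp (continuous_neg.comp continuous_coe_ennreal_ereal)
  · exact ENNReal.continuous_exp.comp continuous_coe_ennreal_ereal

lemma measurable_signedExp (b : Bool) : Measurable (signedExp b) :=
  (continuous_signedExp b).measurable

lemma monotone_signedExp_true : Monotone (signedExp true) := fun x y h => by
  simpa [signedExp] using h

lemma antitone_signedExp_false : Antitone (signedExp false) := fun x y h => by
  simpa [signedExp] using h

lemma signedExp_false_le_one (x : ℝ≥0∞) : signedExp false x ≤ 1 := by
  simp [signedExp, EReal.coe_ennreal_nonneg]

lemma continuous_expIncrement (b : Bool) : Continuous (expIncrement b) := by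
  cases b
  · exact (ENNReal.continuous_sub_left ENNReal.one_ne_top).comp (continuous_signedExp false)
  · exact (ENNReal.continuous_sub_right 1).comp (continuous_signedExp true)

lemma measurable_expIncrement (b : Bool) : Measurable (expIncrement b) :=
  (continuous_expIncrement b).measurable

lemma monotone_expIncrement (b : Bool) : Monotone (expIncrement b) := by
  intro x y h
  cases b
  · exact tsub_le_tsub_left (antitone_signedExp_false h) _
  · exact tsub_le_tsub_right (monotone_signedExp_true h) _

@[simp] lemma expIncrement_zero (b : Bool) : expIncrement b 0 = 0 := by
  cases b <;> simp [expIncrement]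

lemma signedExp_ofReal (b : Bool) {x : ℝ} (hx : 0 ≤ x) :
    signedExp b (ENNReal.ofReal x) = ENNReal.ofReal (Real.exp (boolSign b * x)) := by
  cases b
  · simp [signedExp, boolSign, hx, ← EReal.coe_neg]
  · simp [signedExp, boolSign, hx]

lemma expIncrement_ofReal (b : Bool) {x : ℝ} (hx : 0 ≤ x) :
    expIncrement b (ENNReal.ofReal x) =
      ENNReal.ofReal (boolSign b * (Real.exp (boolSign b * x) - 1)) := by
  cases b
  · have := signedExp_ofReal false hx
    simp only [signedExp] at this
    rw [expIncrement, this, ← ENNReal.ofReal_one, ← ENNReal.ofReal_sub _ (Real.exp_pos _).le]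
    simp [boolSign]
  · have := signedExp_ofReal true hx
    simp only [signedExp] at this
    rw [expIncrement, this, ← ENNReal.ofReal_one, ← ENNReal.ofReal_sub _ zero_le_one]
    simp [boolSign]

lemma boolSign_mul_exp_sub_one_nonneg (b : Bool) {x : ℝ} (hx : 0 ≤ x) :
    0 ≤ boolSign b * (Real.exp (boolSign b * x) - 1) := by
  cases b
  · simpa [boolSign] using hx
  · simpa [boolSign] using hx

@[simp] lemma boolSign_mul_self (b : Bool) : boolSign b * boolSign b = 1 := by
  cases b <;> simp [boolSign]

lemma expIncrement_ne_top (b : Bool) {x : ℝ≥0∞} (hx : x ≠ ⊤) : expIncrement b x ≠ ⊤ := by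
  rw [← ENNReal.ofReal_toReal hx, expIncrement_ofReal b ENNReal.toReal_nonneg]
  exact ENNReal.ofReal_ne_top

lemma expIncrement_false_le_one (x : ℝ≥0∞) : expIncrement false x ≤ 1 := tsub_le_self

/-! ### Laplace functional of a conditional Poisson process. -/

/-- The exponential moment of a Poisson variable. -/
lemma tsum_signedExp_pow_mul_poissonProb (b : Bool) {c m : ℝ≥0∞} (hc : c ≠ ⊤) (hm : m ≠ ⊤) :
    ∑' k : ℕ, signedExp b c ^ k * ENNReal.ofReal (poissonProb m k) =
      signedExp b (expIncrement b c * m) := by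
  lift m to ℝ≥0 using hm
  rw [← ENNReal.ofReal_toReal hc, signedExp_ofReal b ENNReal.toReal_nonneg,
    expIncrement_ofReal b ENNReal.toReal_nonneg]
  set x := c.toReal
  set y := Real.exp (boolSign b * x)
  have hy : 0 ≤ y := (Real.exp_pos _).le
  have hxy : 0 ≤ boolSign b * (y - 1) := boolSign_mul_exp_sub_one_nonneg b ENNReal.toReal_nonneg
  have hsum : HasSum (fun k : ℕ => y ^ k * (Real.exp (-m) * (m : ℝ) ^ k / k.factorial))
      (Real.exp (m * (y - 1))) := by
    have h := (NormedSpace.expSeries_div_hasSum_exp (𝔸 := ℝ) (y * m)).mul_left (Real.exp (-m))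
    rw [← Real.exp_eq_exp_ℝ, ← Real.exp_add] at h
    rw [show (m : ℝ) * (y - 1) = -m + y * m by ring]
    have e (k : ℕ) : y ^ k * (Real.exp (-m) * (m : ℝ) ^ k / k.factorial) =
        Real.exp (-m) * ((y * m) ^ k / k.factorial) := by
      rw [mul_pow]
      ring
    simpa only [e] using h
  have hterm : ∀ k : ℕ, ENNReal.ofReal y ^ k * ENNReal.ofReal (poissonProb m k) =
      ENNReal.ofReal (y ^ k * (Real.exp (-m) * (m : ℝ) ^ k / k.factorial)) := by
    intro k
    rw [ENNReal.ofReal_mul (by positivity), ENNReal.ofReal_pow hy]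
    simp [poissonProb, poissonMeasure_real_singleton]
  simp_rw [hterm]
  rw [← ENNReal.ofReal_tsum_of_nonneg (fun k => by positivity) hsum.summable, hsum.tsum_eq,
    ← ENNReal.ofReal_coe_nnreal, ← ENNReal.ofReal_mul hxy, signedExp_ofReal b (by positivity),
    ← mul_assoc, ← mul_assoc, boolSign_mul_self, one_mul, mul_comm]

lemma ENNReal.tsum_pi_prod {d : ℕ} (f : Fin d → ℕ → ℝ≥0∞) :
    ∑' k : Fin d → ℕ, ∏ i, f i (k i) = ∏ i, ∑' k, f i k := by
  induction d with
  | zero => simp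
  | succ d ih =>
    rw [← (Fin.consEquiv fun _ => ℕ).tsum_eq, ENNReal.tsum_prod', Fin.prod_univ_succ,
      ← ih, ← ENNReal.tsum_mul_right]
    simp [Fin.prod_univ_succ, Fin.consEquiv, ENNReal.tsum_mul_left]

/-- The measures with densities `X` and `μ⁻[X | G]` agree on `G`, hence integrate every
`G`-measurable `Y` alike, even when the integrals are infinite. -/
lemma lintegral_mul_condLExp {Ω : Type*} {G mΩ : MeasurableSpace Ω} (hG : G ≤ mΩ)
    (μ : Measure Ω) [SigmaFinite (μ.trim hG)] {X Y : Ω → ℝ≥0∞} (hX : Measurable X)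
    (hY : Measurable[G] Y) :
    ∫⁻ ω, Y ω * μ⁻[X | G] ω ∂μ = ∫⁻ ω, Y ω * X ω ∂μ := by
  have hY' : Measurable Y := hY.mono hG le_rfl
  have key : (μ.withDensity (μ⁻[X | G])).trim hG = (μ.withDensity X).trim hG := by
    refine @Measure.ext _ G _ _ fun s hs => ?_
    rw [trim_measurableSet_eq hG hs, trim_measurableSet_eq hG hs, withDensity_apply _ (hG s hs),
      withDensity_apply _ (hG s hs), setLIntegral_condLExp hG _ _ hs]
  have h1 := lintegral_withDensity_eq_lintegral_mul μ (measurable_condLExp' G μ X) hY'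
  have h2 := lintegral_withDensity_eq_lintegral_mul μ hX hY'
  rw [← lintegral_trim hG hY, key, lintegral_trim hG hY, h2] at h1
  simpa only [Pi.mul_apply, mul_comm] using h1.symm

lemma lintegral_mul_condExp_indicator {Ω : Type*} {G mΩ : MeasurableSpace Ω} (hG : G ≤ mΩ)
    (μ : Measure Ω) [IsProbabilityMeasure μ] {E : Set Ω} (hE : MeasurableSet E) {Y : Ω → ℝ≥0∞}
    (hY : Measurable[G] Y) :
    ∫⁻ ω, Y ω * ENNReal.ofReal ((μ⟦E | G⟧) ω) ∂μ = ∫⁻ ω, Y ω * E.indicator 1 ω ∂μ := by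
  have hint : Integrable (E.indicator fun _ => (1 : ℝ)) μ := (integrable_const 1).indicator hE
  have h0 : 0 ≤ᵐ[μ] E.indicator fun _ => (1 : ℝ) :=
    Eventually.of_forall fun ω => indicator_nonneg (fun _ _ => zero_le_one) ω
  have h1 : (fun ω => ENNReal.ofReal (E.indicator (fun _ => (1 : ℝ)) ω)) = E.indicator 1 := by
    ext ω
    by_cases h : ω ∈ E <;> simp [h]
  rw [← lintegral_mul_condLExp hG μ (measurable_one.indicator hE) hY, ← h1]
  refine lintegral_congr_ae ?_
  filter_upwards [condLExp_ofReal G hint h0] with ω hω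
  rw [hω]

/-- Monotone convergence. For the negative sign the integrands decrease, so the first must have a
finite integral; this is the role of `hYb`. -/
lemma tendsto_lintegral_mul_signedExp {Ω : Type*} [MeasurableSpace Ω] {μ : Measure Ω}
    {Y : Ω → ℝ≥0∞} (b : Bool) (hY : Measurable Y)
    (hYb : b = false → ∫⁻ ω, Y ω ∂μ ≠ ⊤) {u : ℕ → Ω → ℝ≥0∞} {v : Ω → ℝ≥0∞}
    (hu : ∀ n, Measurable (u n)) (hmono : ∀ ω, Monotone fun n => u n ω)
    (hlim : ∀ ω, Tendsto (fun n => u n ω) atTop (𝓝 (v ω))) :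
    Tendsto (fun n => ∫⁻ ω, Y ω * signedExp b (u n ω) ∂μ) atTop
      (𝓝 (∫⁻ ω, Y ω * signedExp b (v ω) ∂μ)) := by
  have hm (n) : AEMeasurable (fun ω => Y ω * signedExp b (u n ω)) μ :=
    (hY.mul ((measurable_signedExp b).comp (hu n))).aemeasurable
  have hlim' (ω) : Tendsto (fun n => signedExp b (u n ω)) atTop (𝓝 (signedExp b (v ω))) :=
    ((continuous_signedExp b).tendsto _).comp (hlim ω)
  cases b
  · refine lintegral_tendsto_of_tendsto_of_antitone hm (Eventually.of_forall fun ω i j hij =>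
      mul_le_mul_right (antitone_signedExp_false (hmono ω hij)) _) ?_ ?_
    · refine ne_top_of_le_ne_top (hYb rfl) (lintegral_mono fun ω => ?_)
      exact mul_le_of_le_one_right' (signedExp_false_le_one _)
    · filter_upwards [ae_lt_top hY (hYb rfl)] with ω hω
      exact ENNReal.Tendsto.const_mul (hlim' ω) (Or.inr hω.ne)
  · refine lintegral_tendsto_of_tendsto_of_monotone hm (Eventually.of_forall fun ω i j hij =>
      mul_le_mul_right (monotone_signedExp_true (hmono ω hij)) _) (Eventually.of_forall fun ω => ?_)
    refine ENNReal.Tendsto.const_mul (hlim' ω) (Or.inl (ne_of_gt ?_))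
    exact zero_lt_one.trans_le (by simp [signedExp, EReal.coe_ennreal_nonneg])

section
variable {Ω : Type*} {G mΩ : MeasurableSpace Ω} {μ : Measure Ω} [IsProbabilityMeasure μ]
  {X Λ : Ω → Measure ℝ} {Y : Ω → ℝ≥0∞}

/-- Split according to the vector `k` of counts. Conditional independence turns the weight of each
`k` into a product, and the sum over `k` factors into one-dimensional Poisson moments. -/
lemma IsPoissonGiven.lintegral_mul_signedExp_sum (hP : IsPoissonGiven μ G X Λ) (hG : G ≤ mΩ)
    (hXm : Measurable X) (hX : ∀ ω, IsPointMeasure (X ω)) (hY : Measurable[G] Y) (b : Bool)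
    {d : ℕ} {A : Fin d → Set ℝ} {c : Fin d → ℝ≥0∞} (hA : ∀ i, MeasurableSet (A i))
    (hdisj : Pairwise fun i j => Disjoint (A i) (A j)) (hbdd : ∀ i, Bornology.IsBounded (A i))
    (hΛ : ∀ i ω, Λ ω (A i) ≠ ⊤) (hc : ∀ i, c i ≠ ⊤) :
    ∫⁻ ω, Y ω * signedExp b (∑ i, c i * X ω (A i)) ∂μ =
      ∫⁻ ω, Y ω * signedExp b (∑ i, expIncrement b (c i) * Λ ω (A i)) ∂μ := by
  have hY' : Measurable Y := hY.mono hG le_rfl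
  set E : (Fin d → ℕ) → Set Ω := fun k => {ω | ∀ i, X ω (A i) = (k i : ℝ≥0∞)} with hE
  have hEm (k) : MeasurableSet (E k) := by
    have : E k = ⋂ i, (fun ω => X ω (A i)) ⁻¹' {(k i : ℝ≥0∞)} := by ext; simp [E]
    rw [this]
    exact MeasurableSet.iInter fun i =>
      (Measure.measurable_coe (hA i)).comp hXm (measurableSet_singleton _)
  set W : (Fin d → ℕ) → ℝ≥0∞ := fun k => ∏ i, signedExp b (c i) ^ k i
  set p : (Fin d → ℕ) → Ω → ℝ≥0∞ := fun k ω => ENNReal.ofReal ((μ⟦E k | G⟧) ω)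
  have hpm (k) : AEMeasurable (p k) μ :=
    (stronglyMeasurable_condExp.mono hG).measurable.ennreal_ofReal.aemeasurable
  have hp : ∀ᵐ ω ∂μ, ∀ k, p k ω = ∏ i, ENNReal.ofReal (poissonProb (Λ ω (A i)) (k i)) := by
    refine ae_all_iff.2 fun k => ?_
    filter_upwards [hP d A k hA hdisj] with ω hω
    simp only [p, E, hω]
    refine ENNReal.ofReal_prod_of_nonneg fun i _ => ?_
    unfold poissonProb
    split_ifs <;> positivity
  have hsum (ω) : signedExp b (∑ i, c i * X ω (A i)) =
      ∑' k, (E k).indicator 1 ω * W k := by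
    -- Bounded sets have finite integer counts, so `ω` lies in exactly one event `E k`.
    choose k hk using fun i => (hX ω).1 (A i) (hA i) (hbdd i)
    rw [tsum_eq_single k]
    · have : ω ∈ E k := hk
      simp [this, W, signedExp_sum, hk, signedExp_mul_natCast]
    · intro k' hk'
      have : ω ∉ E k' := fun h => hk' (funext fun i => by
        have := (h i).symm.trans (hk i)
        exact_mod_cast this)
      simp [this]
  calc ∫⁻ ω, Y ω * signedExp b (∑ i, c i * X ω (A i)) ∂μ
      = ∫⁻ ω, ∑' k, W k * (Y ω * (E k).indicator 1 ω) ∂μ := by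
        refine lintegral_congr fun ω => ?_
        rw [hsum, ← ENNReal.tsum_mul_left]
        exact tsum_congr fun k => by ring
    _ = ∑' k, W k * ∫⁻ ω, Y ω * (E k).indicator 1 ω ∂μ := by
        have hm (k) : Measurable fun ω => Y ω * (E k).indicator (1 : Ω → ℝ≥0∞) ω :=
          hY'.mul (measurable_one.indicator (hEm k))
        rw [lintegral_tsum fun k => ((hm k).const_mul _).aemeasurable]
        exact tsum_congr fun k => lintegral_const_mul _ (hm k)
    _ = ∑' k, W k * ∫⁻ ω, Y ω * p k ω ∂μ := by
        simp_rw [p, lintegral_mul_condExp_indicator hG μ (hEm _) hY]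
    _ = ∫⁻ ω, ∑' k, W k * (Y ω * p k ω) ∂μ := by
        have hm (k) : AEMeasurable (fun ω => Y ω * p k ω) μ := hY'.aemeasurable.mul (hpm k)
        rw [lintegral_tsum fun k => (hm k).const_mul _]
        exact tsum_congr fun k => (lintegral_const_mul'' _ (hm k)).symm
    _ = ∫⁻ ω, Y ω * signedExp b (∑ i, expIncrement b (c i) * Λ ω (A i)) ∂μ := by
        refine lintegral_congr_ae ?_
        filter_upwards [hp] with ω hω
        simp_rw [hω, signedExp_sum,
          ← fun i => tsum_signedExp_pow_mul_poissonProb b (hc i) (hΛ i ω)]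
        rw [← ENNReal.tsum_pi_prod, ← ENNReal.tsum_mul_left]
        refine tsum_congr fun k => ?_
        rw [Finset.prod_mul_distrib]
        ring

lemma IsPoissonGiven.lintegral_mul_signedExp_simpleFunc (hP : IsPoissonGiven μ G X Λ)
    (hG : G ≤ mΩ) (hXm : Measurable X) (hX : ∀ ω, IsPointMeasure (X ω)) (hY : Measurable[G] Y)
    (b : Bool) {S : Set ℝ} (hS : MeasurableSet S) (hSb : Bornology.IsBounded S)
    (hΛ : ∀ ω, Λ ω S ≠ ⊤) (f : SimpleFunc ℝ ℝ≥0∞) (hf : ∀ x, f x ≠ ⊤) :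
    ∫⁻ ω, Y ω * signedExp b (∫⁻ x in S, f x ∂X ω) ∂μ =
      ∫⁻ ω, Y ω * signedExp b (∫⁻ x in S, expIncrement b (f x) ∂Λ ω) ∂μ := by
  -- The level sets of `f`, enumerated by `Fin d`, are the disjoint sets of the preceding lemma.
  set e := f.range.equivFin
  have hsum (g : ℝ≥0∞ → ℝ≥0∞) (ν : Measure ℝ) : ∫⁻ x in S, g (f x) ∂ν =
      ∑ i, g (e.symm i) * ν (f ⁻¹' {(e.symm i : ℝ≥0∞)} ∩ S) := by
    have h1 : ∫⁻ x in S, g (f x) ∂ν = (f.map g).lintegral (ν.restrict S) := by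
      rw [← SimpleFunc.lintegral_eq_lintegral]
      rfl
    rw [h1, SimpleFunc.map_lintegral, ← Finset.sum_coe_sort, ← e.symm.sum_comp]
    refine Finset.sum_congr rfl fun i _ => ?_
    rw [Measure.restrict_apply (f.measurableSet_preimage _)]
  have h1 (ω) := hsum id (X ω)
  have h2 (ω) := hsum (expIncrement b) (Λ ω)
  simp only [id] at h1
  simp_rw [h1, h2]
  refine hP.lintegral_mul_signedExp_sum hG hXm hX hY b
    (fun i => (f.measurableSet_preimage _).inter hS) ?_ (fun i => hSb.subset inter_subset_right)
    (fun i ω => measure_ne_top_of_subset inter_subset_right (hΛ ω)) fun i => ?_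
  · intro i j hij
    refine Disjoint.mono inter_subset_left inter_subset_left ?_
    refine Disjoint.preimage _ (disjoint_singleton.2 fun h => hij ?_)
    exact e.symm.injective (Subtype.ext h)
  · obtain ⟨x, hx⟩ := SimpleFunc.mem_range.1 (e.symm i).2
    exact hx ▸ hf x

/-- The Laplace functional of a conditional Poisson process. -/
lemma IsPoissonGiven.lintegral_mul_signedExp (hP : IsPoissonGiven μ G X Λ)
    (hG : G ≤ mΩ) (hXm : Measurable X) (hX : ∀ ω, IsPointMeasure (X ω)) (hΛm : Measurable Λ)
    (hY : Measurable[G] Y) (b : Bool) (hYb : b = false → ∫⁻ ω, Y ω ∂μ ≠ ⊤)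
    {S : Set ℝ} (hS : MeasurableSet S) (hSb : Bornology.IsBounded S)
    (hΛ : ∀ ω, Λ ω S ≠ ⊤) {g : ℝ → ℝ≥0∞} (hg : Measurable g) :
    ∫⁻ ω, Y ω * signedExp b (∫⁻ x in S, g x ∂X ω) ∂μ =
      ∫⁻ ω, Y ω * signedExp b (∫⁻ x in S, expIncrement b (g x) ∂Λ ω) ∂μ := by
  have hlim (h : ℝ≥0∞ → ℝ≥0∞) (hc : Continuous h) (hmono : Monotone h) {Z : Ω → Measure ℝ}
      (hZ : Measurable Z) :
      Tendsto (fun n => ∫⁻ ω, Y ω *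
          signedExp b (∫⁻ x in S, h (SimpleFunc.eapprox g n x) ∂Z ω) ∂μ) atTop
        (𝓝 (∫⁻ ω, Y ω * signedExp b (∫⁻ x in S, h (g x) ∂Z ω) ∂μ)) := by
    have hm (n) : Measurable fun x => h (SimpleFunc.eapprox g n x) :=
      hc.measurable.comp (SimpleFunc.measurable _)
    have hmon (x) : Monotone fun n => h (SimpleFunc.eapprox g n x) :=
      fun i j hij => hmono (SimpleFunc.monotone_eapprox g hij x)
    refine tendsto_lintegral_mul_signedExp b (hY.mono hG le_rfl) hYb (fun n => ?_)
      (fun ω i j hij => lintegral_mono fun x => hmon x hij) fun ω => ?_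
    · simp_rw [← lintegral_indicator hS]
      exact (Measure.measurable_lintegral ((hm n).indicator hS)).comp hZ
    · exact lintegral_tendsto_of_tendsto_of_monotone (fun n => (hm n).aemeasurable)
        (Eventually.of_forall hmon)
        (Eventually.of_forall fun x =>
          (hc.tendsto _).comp (SimpleFunc.tendsto_eapprox hg x))
  -- Both sides are limits along the same simple functions increasing to `g`, because `expIncrement
  -- b` is continuous and monotone.
  refine tendsto_nhds_unique (hlim id continuous_id monotone_id hXm) ?_
  refine (hlim _ (continuous_expIncrement b) (monotone_expIncrement b) hΛm).congr fun n => ?_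
  exact (hP.lintegral_mul_signedExp_simpleFunc hG hXm hX hY b hS hSb hΛ _
    fun x => (SimpleFunc.eapprox_lt_top g n x).ne).symm

end

/-! ### Point measures and convolution. -/

lemma IsPointMeasure.measure_ne_top {ν : Measure ℝ} (hν : IsPointMeasure ν) {A : Set ℝ}
    (hA : MeasurableSet A) (hb : Bornology.IsBounded A) : ν A ≠ ⊤ := by
  obtain ⟨k, hk⟩ := hν.1 A hA hb
  simp [hk]

lemma IsPointMeasure.isLocallyFiniteMeasure {ν : Measure ℝ} (hν : IsPointMeasure ν) :
    IsLocallyFiniteMeasure ν :=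
  ⟨fun x => ⟨Metric.ball x 1, Metric.ball_mem_nhds x one_pos,
    (hν.measure_ne_top measurableSet_ball Metric.isBounded_ball).lt_top⟩⟩

/-- Tonelli and the translation `t = u + v`, where `u` is the parent's time and `v` the child's
delay. Extending `g` by zero to `g'` encodes the constraint `u < t`. -/
lemma lintegral_convolution_mul (ν : Measure ℝ) [SFinite ν] {g f : ℝ → ℝ≥0∞} (hg : Measurable g)
    (hf : Measurable f) :
    ∫⁻ t in Ioi 0, (∫⁻ u in Ioo 0 t, g (t - u) ∂ν) * f t =
      ∫⁻ u in Ioi 0, (∫⁻ v in Ioi 0, g v * f (u + v)) ∂ν := by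
  set g' : ℝ → ℝ≥0∞ := (Ioi 0).indicator g
  have hg' : Measurable g' := hg.indicator measurableSet_Ioi
  have h1 (t : ℝ) : (Ioi 0).indicator (fun t => (∫⁻ u in Ioo 0 t, g (t - u) ∂ν) * f t) t =
      ∫⁻ u in Ioi 0, g' (t - u) * f t ∂ν := by
    rw [lintegral_mul_const _ (by fun_prop)]
    have : ∫⁻ u in Ioi 0, g' (t - u) ∂ν = ∫⁻ u in Ioo 0 t, g (t - u) ∂ν := by
      rw [← lintegral_indicator measurableSet_Ioi, ← lintegral_indicator measurableSet_Ioo]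
      refine lintegral_congr fun u => ?_
      by_cases h0 : 0 < u <;> by_cases ht : u < t <;> simp [g', indicator, h0, ht]
    rw [this]
    by_cases ht : 0 < t
    · simp [ht]
    · simp [ht, Ioo_eq_empty]
  rw [← lintegral_indicator measurableSet_Ioi]
  simp_rw [h1]
  rw [lintegral_lintegral_swap (by fun_prop)]
  refine lintegral_congr fun u => ?_
  rw [← lintegral_add_left_eq_self _ u, ← lintegral_indicator measurableSet_Ioi]
  refine lintegral_congr fun v => ?_
  by_cases hv : 0 < v <;> simp [g', indicator, hv]

lemma measurable_lintegral_Ioo_sub (ν : Measure ℝ) [SFinite ν] {g : ℝ → ℝ≥0∞}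
    (hg : Measurable g) : Measurable fun t => ∫⁻ u in Ioo 0 t, g (t - u) ∂ν := by
  have h (t : ℝ) : ∫⁻ u in Ioo 0 t, g (t - u) ∂ν =
      ∫⁻ u, (Ioi 0).indicator 1 u * (Ioi 0).indicator g (t - u) ∂ν := by
    rw [← lintegral_indicator measurableSet_Ioo]
    refine lintegral_congr fun u => ?_
    by_cases h0 : 0 < u <;> by_cases ht : u < t <;> simp [indicator, h0, ht]
  simp_rw [h]
  have h1 : Measurable ((Ioi (0 : ℝ)).indicator (1 : ℝ → ℝ≥0∞)) :=
    measurable_one.indicator measurableSet_Ioi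
  have h2 : Measurable ((Ioi (0 : ℝ)).indicator g) := hg.indicator measurableSet_Ioi
  exact Measurable.lintegral_prod_right' (f := fun p : ℝ × ℝ =>
    (Ioi 0).indicator 1 p.2 * (Ioi 0).indicator g (p.1 - p.2)) (by fun_prop)

/-! ### Cluster exponents and their limit at large age. -/

/-- The value at age `u` of the log-Laplace exponent of the first `M` generations of descendants
of a point of generation `j`. -/
noncomputable def clusterExponent (γ : ℕ → ℝ → ℝ≥0) (b : Bool) (a : ℝ≥0) : ℕ → ℕ → ℝ → ℝ≥0∞
  | _, 0, _ => a
  | j, M + 1, u => a + ∫⁻ v in Ioc 0 u,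
      (γ (j + 1) v : ℝ≥0∞) * expIncrement b (clusterExponent γ b a (j + 1) M (u - v))

/-- The log-Laplace exponent of the total size of the first `M` generations of descendants of a
point of generation `j`. -/
noncomputable def totalExponent (γ : ℕ → ℝ → ℝ≥0) (b : Bool) (a : ℝ≥0) : ℕ → ℕ → ℝ≥0∞
  | _, 0 => a
  | j, M + 1 => a + l1Norm (γ (j + 1)) * expIncrement b (totalExponent γ b a (j + 1) M)

section
variable (γ : ℕ → ℝ → ℝ≥0) (b : Bool) (a : ℝ≥0)

lemma monotone_clusterExponent (j M : ℕ) : Monotone (clusterExponent γ b a j M) := by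
  induction M generalizing j with
  | zero => exact fun _ _ _ => le_rfl
  | succ M ih =>
    intro u u' h
    simp only [clusterExponent]
    gcongr with v
    exact monotone_expIncrement b (ih _ (by linarith))

lemma measurable_clusterExponent (j M : ℕ) : Measurable (clusterExponent γ b a j M) :=
  (monotone_clusterExponent γ b a j M).measurable

lemma clusterExponent_le_succ (j M : ℕ) (u : ℝ) :
    clusterExponent γ b a j M u ≤ clusterExponent γ b a j (M + 1) u := by
  induction M generalizing j u with
  | zero => exact le_self_add
  | succ M ih =>
    rw [clusterExponent, clusterExponent]
    gcongr with v
    exact monotone_expIncrement b (ih _ _)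

lemma totalExponent_le_succ (j M : ℕ) :
    totalExponent γ b a j M ≤ totalExponent γ b a j (M + 1) := by
  induction M generalizing j with
  | zero => exact le_self_add
  | succ M ih =>
    rw [totalExponent, totalExponent]
    gcongr
    exact monotone_expIncrement b (ih _)

lemma clusterExponent_le_totalExponent (hγ : ∀ n, Measurable (γ n)) (j M : ℕ) (u : ℝ) :
    clusterExponent γ b a j M u ≤ totalExponent γ b a j M := by
  induction M generalizing j u with
  | zero => exact le_rfl
  | succ M ih =>
    rw [clusterExponent, totalExponent]
    gcongr
    calc ∫⁻ v in Ioc 0 u, (γ (j + 1) v : ℝ≥0∞) *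
          expIncrement b (clusterExponent γ b a (j + 1) M (u - v))
        ≤ ∫⁻ v in Ioi 0, (γ (j + 1) v : ℝ≥0∞) * expIncrement b (totalExponent γ b a (j + 1) M) := by
          refine lintegral_mono' (Measure.restrict_mono Ioc_subset_Ioi_self le_rfl) fun v => ?_
          gcongr
          exact monotone_expIncrement b (ih _ _)
      _ = _ := lintegral_mul_const _ (hγ (j + 1)).coe_nnreal_ennreal

variable {γ}

lemma totalExponent_ne_top (hγ1 : ∀ n, l1Norm (γ (n + 1)) ≠ ⊤) (j M : ℕ) :
    totalExponent γ b a j M ≠ ⊤ := by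
  induction M generalizing j with
  | zero => exact ENNReal.coe_ne_top
  | succ M ih =>
    exact ENNReal.add_ne_top.2 ⟨ENNReal.coe_ne_top,
      ENNReal.mul_ne_top (hγ1 _) (expIncrement_ne_top b (ih _))⟩

/-- Dominated convergence, by induction on the number of generations: the bound is `γ (j + 1)` times
a finite constant, and the cutoff `v ≤ u` disappears as `u → ∞`. -/
lemma tendsto_clusterExponent (hγ : ∀ n, Measurable (γ n))
    (hγ1 : ∀ n, l1Norm (γ (n + 1)) ≠ ⊤) (j M : ℕ) :
    Tendsto (clusterExponent γ b a j M) atTop (𝓝 (totalExponent γ b a j M)) := by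
  induction M generalizing j with
  | zero => exact tendsto_const_nhds
  | succ M ih =>
    simp only [clusterExponent, totalExponent]
    refine tendsto_const_nhds.add ?_
    have hm : Measurable fun v => (γ (j + 1) v : ℝ≥0∞) := (hγ _).coe_nnreal_ennreal
    rw [l1Norm, ← lintegral_mul_const _ hm]
    set K := clusterExponent γ b a (j + 1) M
    have hK : Measurable K := measurable_clusterExponent γ b a _ _
    have h1 (u : ℝ) : ∫⁻ v in Ioc 0 u, (γ (j + 1) v : ℝ≥0∞) * expIncrement b (K (u - v)) =
        ∫⁻ v in Ioi 0, (Iic u).indicator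
          (fun v => (γ (j + 1) v : ℝ≥0∞) * expIncrement b (K (u - v))) v := by
      rw [setLIntegral_indicator measurableSet_Iic, ← Ioi_inter_Iic, inter_comm]
    simp_rw [h1]
    have hψ := measurable_expIncrement b
    refine tendsto_lintegral_filter_of_dominated_convergence
      (fun v => (γ (j + 1) v : ℝ≥0∞) * expIncrement b (totalExponent γ b a (j + 1) M))
      (Eventually.of_forall fun u => ?_) (Eventually.of_forall fun u =>
        Eventually.of_forall fun v => ?_) ?_ (Eventually.of_forall fun v => ?_)
    · exact Measurable.indicator (by fun_prop) measurableSet_Iic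
    · refine indicator_le_self' (fun _ _ => zero_le) v |>.trans ?_
      gcongr
      exact monotone_expIncrement b (clusterExponent_le_totalExponent _ _ _ hγ _ _ _)
    · rw [lintegral_mul_const _ hm]
      exact ENNReal.mul_ne_top (hγ1 j) (expIncrement_ne_top b (totalExponent_ne_top b a hγ1 _ _))
    · have h2 : Tendsto (fun u => (γ (j + 1) v : ℝ≥0∞) * expIncrement b (K (u - v))) atTop
          (𝓝 ((γ (j + 1) v : ℝ≥0∞) * expIncrement b (totalExponent γ b a (j + 1) M))) := by
        refine ENNReal.Tendsto.const_mul ?_ (Or.inr ENNReal.coe_ne_top)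
        exact ((continuous_expIncrement b).tendsto _).comp
          ((ih _).comp (tendsto_atTop_add_const_right _ (-v) tendsto_id))
      refine h2.congr' ?_
      filter_upwards [eventually_ge_atTop v] with u hu
      simp [indicator, hu]

end

/-! ### Integrating out the generations. -/

section
variable {Ω : Type*} {γ : ℕ → ℝ → ℝ≥0} {N : ℕ → Ω → Measure ℝ}

/-- The intensity measure of the `n`-th generation. -/
noncomputable def generationMeasure (γ : ℕ → ℝ → ℝ≥0) (N : ℕ → Ω → Measure ℝ) (n : ℕ) (ω : Ω) :
    Measure ℝ :=
  (volume.restrict (Ioi 0)).withDensity (generationIntensity γ N n ω)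

lemma lintegral_generationMeasure_zero (hγ : ∀ n, Measurable (γ n)) {f : ℝ → ℝ≥0∞}
    (hf : Measurable f) (ω : Ω) :
    ∫⁻ t, f t ∂(generationMeasure γ N 0 ω) = ∫⁻ t in Ioi 0, (γ 0 t : ℝ≥0∞) * f t :=
  lintegral_withDensity_eq_lintegral_mul _ (hγ 0).coe_nnreal_ennreal hf

/-- The sigma-algebra generated by the generations before the `n`-th. -/
abbrev generationSigma (N : ℕ → Ω → Measure ℝ) (n : ℕ) : MeasurableSpace Ω :=
  ⨆ (k : ℕ) (_ : k < n), MeasurableSpace.comap (N k) inferInstance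

lemma measurable_generationSigma_sum (n : ℕ) (a : ℝ≥0) (t : ℝ) :
    Measurable[generationSigma N n] fun ω => ∑ k ∈ Finset.range n, (a : ℝ≥0∞) * N k ω (Ioc 0 t) := by
  refine Finset.measurable_sum _ fun k hk => Measurable.const_mul ?_ _
  refine (Measure.measurable_coe measurableSet_Ioc).comp ?_
  exact (comap_measurable (N k)).mono (le_iSup₂_of_le k (Finset.mem_range.1 hk) le_rfl) le_rfl

variable [mΩ : MeasurableSpace Ω] {μ : Measure Ω}

lemma lintegral_generationMeasure_succ (hγ : ∀ n, Measurable (γ n))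
    (hN : IsHawkesGenerations μ γ N) {f : ℝ → ℝ≥0∞} (hf : Measurable f) (n : ℕ) (ω : Ω) :
    ∫⁻ t, f t ∂(generationMeasure γ N (n + 1) ω) =
      ∫⁻ u in Ioi 0, (∫⁻ v in Ioi 0, (γ (n + 1) v : ℝ≥0∞) * f (u + v)) ∂(N n ω) := by
  have := (hN.isPointMeasure n ω).isLocallyFiniteMeasure
  have hg : Measurable fun v => (γ (n + 1) v : ℝ≥0∞) := (hγ (n + 1)).coe_nnreal_ennreal
  rw [generationMeasure]
  exact (lintegral_withDensity_eq_lintegral_mul _ (measurable_lintegral_Ioo_sub (N n ω) hg)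
    hf).trans (lintegral_convolution_mul (N n ω) hg hf)

lemma measurable_generationMeasure (hγ : ∀ n, Measurable (γ n))
    (hN : IsHawkesGenerations μ γ N) (n : ℕ) : Measurable (generationMeasure γ N n) := by
  refine Measure.measurable_of_measurable_coe _ fun s hs => ?_
  have hf : Measurable (s.indicator (1 : ℝ → ℝ≥0∞)) := measurable_one.indicator hs
  simp_rw [← lintegral_indicator_one hs]
  cases n with
  | zero =>
    simp_rw [lintegral_generationMeasure_zero hγ hf]
    exact measurable_const
  | succ n =>
    simp_rw [lintegral_generationMeasure_succ hγ hN hf, ← lintegral_indicator measurableSet_Ioi]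
    refine (Measure.measurable_lintegral (Measurable.indicator ?_ measurableSet_Ioi)).comp
      (hN.measurable n)
    have hg : Measurable fun v => (γ (n + 1) v : ℝ≥0∞) := (hγ (n + 1)).coe_nnreal_ennreal
    simp_rw [lintegral_indicator measurableSet_Ioi]
    exact Measurable.lintegral_prod_right' (f := fun p : ℝ × ℝ => (γ (n + 1) p.2 : ℝ≥0∞) *
      s.indicator 1 (p.1 + p.2)) (by fun_prop)

lemma setLIntegral_generationMeasure_succ (hγ : ∀ n, Measurable (γ n))
    (hN : IsHawkesGenerations μ γ N) {f : ℝ → ℝ≥0∞} (hf : Measurable f) (n : ℕ) (ω : Ω) (t : ℝ) :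
    ∫⁻ s in Ioc 0 t, f (t - s) ∂(generationMeasure γ N (n + 1) ω) =
      ∫⁻ u in Ioc 0 t, (∫⁻ v in Ioc 0 (t - u), (γ (n + 1) v : ℝ≥0∞) * f (t - u - v))
        ∂(N n ω) := by
  rw [← lintegral_indicator measurableSet_Ioc, lintegral_generationMeasure_succ hγ hN
    (Measurable.indicator (by fun_prop) measurableSet_Ioc),
    ← lintegral_indicator measurableSet_Ioi, ← lintegral_indicator measurableSet_Ioc]
  refine lintegral_congr fun u => ?_
  by_cases hu : 0 < u
  swap
  · simp [indicator, hu]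
  rw [indicator_of_mem (show u ∈ Ioi 0 from hu)]
  have h1 : ∫⁻ v in Ioi 0, (γ (n + 1) v : ℝ≥0∞) * (Ioc 0 t).indicator (fun s => f (t - s)) (u + v) =
      ∫⁻ v in Ioc 0 (t - u), (γ (n + 1) v : ℝ≥0∞) * f (t - u - v) := by
    rw [← lintegral_indicator measurableSet_Ioi, ← lintegral_indicator measurableSet_Ioc]
    refine lintegral_congr fun v => ?_
    by_cases hv : 0 < v
    · have e1 : u + v ∈ Ioc 0 t ↔ v ∈ Ioc 0 (t - u) :=
        ⟨fun h => ⟨hv, by linarith [h.2]⟩, fun h => ⟨by linarith, by linarith [h.2]⟩⟩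
      by_cases h : v ∈ Ioc 0 (t - u)
      · rw [indicator_of_mem (show v ∈ Ioi 0 from hv), indicator_of_mem h,
          indicator_of_mem (e1.2 h), sub_sub]
      · rw [indicator_of_mem (show v ∈ Ioi 0 from hv), indicator_of_notMem h,
          indicator_of_notMem (fun h' => h (e1.1 h')), mul_zero]
    · simp [indicator, hv]
  rw [h1]
  by_cases ht : u ≤ t
  · simp [hu, ht]
  · rw [Ioc_eq_empty (by linarith : ¬ 0 < t - u)]
    simp [ht]

lemma generationMeasure_Ioc_ne_top (hγ : ∀ n, Measurable (γ n))
    (hN : IsHawkesGenerations μ γ N) (h0 : ∀ t, ∫⁻ s in Ioc 0 t, (γ 0 s : ℝ≥0∞) ≠ ⊤)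
    (hγ1 : ∀ n, l1Norm (γ (n + 1)) ≠ ⊤) (n : ℕ) (ω : Ω) (t : ℝ) :
    generationMeasure γ N n ω (Ioc 0 t) ≠ ⊤ := by
  cases n with
  | zero =>
    rw [← lintegral_indicator_one measurableSet_Ioc, lintegral_generationMeasure_zero hγ
      (measurable_one.indicator measurableSet_Ioc)]
    refine ne_top_of_le_ne_top (h0 t) ?_
    rw [← lintegral_indicator measurableSet_Ioc]
    refine (setLIntegral_le_lintegral _ _).trans (lintegral_mono fun s => ?_)
    by_cases h : s ∈ Ioc 0 t <;> simp [h]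
  | succ n =>
    have h := setLIntegral_generationMeasure_succ hγ hN (measurable_one (α := ℝ≥0∞)) n ω t
    simp only [Pi.one_apply, lintegral_one, Measure.restrict_apply_univ, mul_one] at h
    rw [h]
    refine ne_top_of_le_ne_top (b := ∫⁻ u in Ioc 0 t, l1Norm (γ (n + 1)) ∂(N n ω)) ?_
      (lintegral_mono fun u => lintegral_mono' (Measure.restrict_mono Ioc_subset_Ioi_self le_rfl)
        le_rfl)
    rw [setLIntegral_const]
    exact ENNReal.mul_ne_top (hγ1 n) ((hN.isPointMeasure n ω).measure_ne_top measurableSet_Ioc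
      (Metric.isBounded_Ioc _ _))

lemma generationSigma_le (hN : IsHawkesGenerations μ γ N) (n : ℕ) : generationSigma N n ≤ mΩ :=
  iSup₂_le fun k _ => (hN.measurable k).comap_le

lemma measurable_sum_generations (hN : IsHawkesGenerations μ γ N) (n : ℕ) (a : ℝ≥0) (t : ℝ) :
    Measurable fun ω => ∑ k ∈ Finset.range n, (a : ℝ≥0∞) * N k ω (Ioc 0 t) :=
  (measurable_generationSigma_sum n a t).mono (generationSigma_le hN n) le_rfl

variable [IsProbabilityMeasure μ]

lemma lintegral_signedExp_false_ne_top (f : Ω → ℝ≥0∞) : ∫⁻ ω, signedExp false (f ω) ∂μ ≠ ⊤ := by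
  refine ne_top_of_le_ne_top ENNReal.one_ne_top
    ((lintegral_mono fun ω => signedExp_false_le_one _).trans ?_)
  simp

/-- Each point of generation `n` carries the exponent of its own `M` generations of descendants,
which replaces the generations `n + 1, …, n + M`. -/
lemma lintegral_signedExp_generations (hγ : ∀ n, Measurable (γ n))
    (hN : IsHawkesGenerations μ γ N) (h0 : ∀ t, ∫⁻ s in Ioc 0 t, (γ 0 s : ℝ≥0∞) ≠ ⊤)
    (hγ1 : ∀ n, l1Norm (γ (n + 1)) ≠ ⊤) (b : Bool) (a : ℝ≥0) (t : ℝ) (n M : ℕ) :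
    ∫⁻ ω, signedExp b (∑ k ∈ Finset.range n, a * N k ω (Ioc 0 t) +
        ∫⁻ s in Ioc 0 t, clusterExponent γ b a n M (t - s) ∂(N n ω)) ∂μ =
      ∫⁻ ω, signedExp b (∑ k ∈ Finset.range (n + M + 1), a * N k ω (Ioc 0 t)) ∂μ := by
  induction M generalizing n with
  | zero => simp [clusterExponent, Finset.sum_range_succ]
  | succ M ih =>
    have hK := measurable_clusterExponent γ b a (n + 1) M
    have hψ := measurable_expIncrement b
    -- It remains to average over generation `n + 1` given the earlier ones; the resulting integral
    -- against `N n`, plus `a` per point, is the recursion for `clusterExponent`.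
    rw [show n + (M + 1) + 1 = n + 1 + M + 1 by ring, ← ih (n + 1)]
    simp_rw [clusterExponent, lintegral_add_left measurable_const, setLIntegral_const, ← add_assoc,
      ← Finset.sum_range_succ, signedExp_add]
    have hP := (hN.poisson (n + 1)).lintegral_mul_signedExp (generationSigma_le hN (n + 1))
      (hN.measurable _) (hN.isPointMeasure _) (measurable_generationMeasure hγ hN (n + 1))
      ((measurable_signedExp b).comp (measurable_generationSigma_sum (n + 1) a t)) b
      (by rintro rfl; exact lintegral_signedExp_false_ne_top _) measurableSet_Ioc
      (Metric.isBounded_Ioc 0 t)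
      (fun ω => generationMeasure_Ioc_ne_top hγ hN h0 hγ1 (n + 1) ω t)
      (g := fun s => clusterExponent γ b a (n + 1) M (t - s)) (by fun_prop)
    refine Eq.trans (lintegral_congr fun ω => ?_) hP.symm
    rw [Function.comp_apply]
    congr 2
    exact (setLIntegral_generationMeasure_succ hγ hN (hψ.comp hK) n ω t).symm

lemma lintegral_signedExp_first_generations (hγ : ∀ n, Measurable (γ n))
    (hN : IsHawkesGenerations μ γ N) (h0 : ∀ t, ∫⁻ s in Ioc 0 t, (γ 0 s : ℝ≥0∞) ≠ ⊤)
    (hγ1 : ∀ n, l1Norm (γ (n + 1)) ≠ ⊤) (b : Bool) (a : ℝ≥0) (t : ℝ) (M : ℕ) :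
    ∫⁻ ω, signedExp b (∑ k ∈ Finset.range (M + 1), a * N k ω (Ioc 0 t)) ∂μ =
      signedExp b (∫⁻ s in Ioc 0 t,
        (γ 0 s : ℝ≥0∞) * expIncrement b (clusterExponent γ b a 0 M (t - s))) := by
  have hK := measurable_clusterExponent γ b a 0 M
  have hψ := measurable_expIncrement b
  have h1 := lintegral_signedExp_generations hγ hN h0 hγ1 b a t 0 M
  have hP := (hN.poisson 0).lintegral_mul_signedExp (generationSigma_le hN 0)
    (hN.measurable _) (hN.isPointMeasure _) (measurable_generationMeasure hγ hN 0)
    -- Nothing precedes generation `0`, and its intensity is deterministic, so the expectation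
    -- becomes explicit.
    (Y := 1) measurable_const b (by simp) measurableSet_Ioc (Metric.isBounded_Ioc 0 t)
    (fun ω => generationMeasure_Ioc_ne_top hγ hN h0 hγ1 0 ω t)
    (g := fun s => clusterExponent γ b a 0 M (t - s)) (by fun_prop)
  simp only [Finset.range_zero, Finset.sum_empty, zero_add] at h1
  simp only [Pi.one_apply, one_mul] at hP
  rw [← h1, hP]
  have h2 (ω) : ∫⁻ s in Ioc 0 t, expIncrement b (clusterExponent γ b a 0 M (t - s))
      ∂(generationMeasure γ N 0 ω) = ∫⁻ s in Ioc 0 t,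
        (γ 0 s : ℝ≥0∞) * expIncrement b (clusterExponent γ b a 0 M (t - s)) := by
    rw [← lintegral_indicator measurableSet_Ioc, lintegral_generationMeasure_zero hγ
      (Measurable.indicator (by fun_prop) measurableSet_Ioc), ← lintegral_indicator
      measurableSet_Ioc, ← lintegral_indicator measurableSet_Ioi]
    refine lintegral_congr fun s => ?_
    by_cases hs : 0 < s <;> by_cases hst : s ≤ t <;> simp [indicator, hs, hst]
  change ∫⁻ ω, signedExp b (∫⁻ s in Ioc 0 t, expIncrement b (clusterExponent γ b a 0 M (t - s))
      ∂(generationMeasure γ N 0 ω)) ∂μ = _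
  simp_rw [h2]
  simp

lemma lintegral_signedExp_hawkesCount (hγ : ∀ n, Measurable (γ n))
    (hN : IsHawkesGenerations μ γ N) (h0 : ∀ t, ∫⁻ s in Ioc 0 t, (γ 0 s : ℝ≥0∞) ≠ ⊤)
    (hγ1 : ∀ n, l1Norm (γ (n + 1)) ≠ ⊤) (b : Bool) (a : ℝ≥0) (t : ℝ) :
    ∫⁻ ω, signedExp b (a * hawkesCount N t ω) ∂μ =
      signedExp b (⨆ M, ∫⁻ s in Ioc 0 t,
        (γ 0 s : ℝ≥0∞) * expIncrement b (clusterExponent γ b a 0 M (t - s))) := by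
  have h1 := tendsto_lintegral_mul_signedExp (μ := μ) (Y := 1) b measurable_const (by simp)
    (u := fun M ω => ∑ k ∈ Finset.range (M + 1), (a : ℝ≥0∞) * N k ω (Ioc 0 t))
    (v := fun ω => a * hawkesCount N t ω) (fun M => measurable_sum_generations hN _ a t)
    (fun ω i j hij => Finset.sum_le_sum_of_subset (Finset.range_subset_range.2 (by lia)))
    (fun ω => by
      rw [hawkesCount, Measure.sum_apply _ measurableSet_Ioc, ← ENNReal.tsum_mul_left]
      exact (ENNReal.tendsto_nat_tsum _).comp (tendsto_add_atTop_nat 1))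
  simp only [Pi.one_apply, one_mul] at h1
  refine tendsto_nhds_unique h1 ?_
  simp_rw [lintegral_signedExp_first_generations hγ hN h0 hγ1 b a t]
  refine ((continuous_signedExp b).tendsto _).comp (tendsto_atTop_iSup ?_)
  refine monotone_nat_of_le_succ fun M => lintegral_mono fun s => ?_
  gcongr
  exact monotone_expIncrement b (clusterExponent_le_succ γ b a 0 M _)

end

/-! ### Back to signed extended reals and to the recursion. -/

/-- `x` if `b` is `true`, and `-x` if `b` is `false`. -/
noncomputable def signedCoe : Bool → ℝ≥0∞ → EReal
  | true, x => x
  | false, x => -x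

lemma continuous_signedCoe (b : Bool) : Continuous (signedCoe b) := by
  cases b
  · exact continuous_neg.comp continuous_coe_ennreal_ereal
  · exact continuous_coe_ennreal_ereal

lemma signedExp_eq_exp (b : Bool) (x : ℝ≥0∞) : signedExp b x = EReal.exp (signedCoe b x) := by
  cases b <;> rfl

lemma EReal.coe_ennreal_ofReal_of_nonneg {x : ℝ} (hx : 0 ≤ x) :
    ((ENNReal.ofReal x : ℝ≥0∞) : EReal) = x := by
  rw [EReal.coe_ennreal_ofReal, max_eq_left hx]

lemma signedCoe_ofReal (b : Bool) {x : ℝ} (hx : 0 ≤ x) :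
    signedCoe b (ENNReal.ofReal x) = ((boolSign b * x : ℝ) : EReal) := by
  cases b <;> simp [signedCoe, boolSign, hx]

lemma coe_mul_signedCoe (b : Bool) {c : ℝ} (hc : 0 ≤ c) (x : ℝ≥0∞) :
    (c : EReal) * signedCoe b x = signedCoe b (ENNReal.ofReal c * x) := by
  cases b
  · rw [signedCoe, signedCoe, EReal.coe_ennreal_mul, EReal.coe_ennreal_ofReal_of_nonneg hc, mul_neg]
  · rw [signedCoe, signedCoe, EReal.coe_ennreal_mul, EReal.coe_ennreal_ofReal_of_nonneg hc]

lemma boolSign_mul_signedCoe (b : Bool) {c : ℝ} (hc : 0 ≤ c) (x : ℝ≥0∞) :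
    ((boolSign b * c : ℝ) : EReal) * x = signedCoe b (ENNReal.ofReal c * x) := by
  rw [← coe_mul_signedCoe b hc]
  cases b <;> simp [boolSign, signedCoe]

lemma signedCoe_expIncrement (b : Bool) (x : ℝ≥0∞) :
    signedCoe b (expIncrement b x) = (EReal.exp (signedCoe b x) : EReal) - 1 := by
  rcases eq_or_ne x ⊤ with rfl | hx
  · cases b
    · simp [signedCoe, expIncrement]
    · simp only [signedCoe, expIncrement, EReal.coe_ennreal_top, EReal.exp_top,
        ENNReal.top_sub ENNReal.one_ne_top]
      exact (EReal.top_sub_coe 1).symm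
  · rw [← signedExp_eq_exp, ← ENNReal.ofReal_toReal hx, signedExp_ofReal b ENNReal.toReal_nonneg,
      expIncrement_ofReal b ENNReal.toReal_nonneg, signedCoe_ofReal b
      (boolSign_mul_exp_sub_one_nonneg b ENNReal.toReal_nonneg), ← mul_assoc, boolSign_mul_self,
      one_mul, EReal.coe_ennreal_ofReal_of_nonneg (Real.exp_pos _).le]
    rfl

/-- A point of generation `j` in a tree cut at generation `M` has `n = M - j` generations below it,
and step `n + 1` of the recursion uses `γ (M - n)`; hence the constraint `n + j = M`. -/
lemma hawkesF_eq_totalExponent {γ : ℕ → ℝ → ℝ≥0} (hγ1 : ∀ n, l1Norm (γ (n + 1)) ≠ ⊤) (b : Bool)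
    (a : ℝ≥0) {n j M : ℕ} (h : n + j = M) :
    0 ≤ boolSign b * hawkesF γ (boolSign b * a) M n ∧
      totalExponent γ b a j n = ENNReal.ofReal (boolSign b * hawkesF γ (boolSign b * a) M n) := by
  induction n generalizing j with
  | zero => simp [hawkesF, totalExponent, ← mul_assoc]
  | succ n ih =>
    obtain ⟨h1, h2⟩ := ih (j := j + 1) (by lia)
    have hj : M + 1 - (n + 1) = j + 1 := by lia
    set f := hawkesF γ (boolSign b * a) M n with hf
    have h3 := boolSign_mul_exp_sub_one_nonneg b h1
    have h4 : boolSign b * hawkesF γ (boolSign b * a) M (n + 1) = a +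
        (l1Norm (γ (j + 1))).toReal *
          (boolSign b * (Real.exp (boolSign b * (boolSign b * f)) - 1)) := by
      rw [hawkesF, hj, ← hf, ← mul_assoc (boolSign b) (boolSign b) f, boolSign_mul_self, one_mul,
        mul_add, ← mul_assoc (boolSign b) (boolSign b), boolSign_mul_self]
      ring
    have h5 := mul_nonneg (ENNReal.toReal_nonneg (a := l1Norm (γ (j + 1)))) h3
    rw [h4]
    refine ⟨add_nonneg a.coe_nonneg h5, ?_⟩
    rw [totalExponent, h2, expIncrement_ofReal b h1, ENNReal.ofReal_add a.coe_nonneg h5,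
      ENNReal.ofReal_mul ENNReal.toReal_nonneg, ENNReal.ofReal_toReal (hγ1 j)]
    simp

lemma coe_hawkesF {γ : ℕ → ℝ → ℝ≥0} (hγ1 : ∀ n, l1Norm (γ (n + 1)) ≠ ⊤) (b : Bool) (a : ℝ≥0)
    (M : ℕ) :
    (hawkesF γ (boolSign b * a) M M : EReal) = signedCoe b (totalExponent γ b a 0 M) := by
  obtain ⟨h1, h2⟩ := hawkesF_eq_totalExponent hγ1 b a (add_zero M)
  rw [h2, signedCoe_ofReal b h1, ← mul_assoc, boolSign_mul_self, one_mul]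

/-! ### Averages of the immigration rate. -/

section
variable {g : ℝ → ℝ≥0} {c : ℝ≥0}

lemma setLIntegral_Ioc_ne_top_of_tendsto_div
    (hc : Tendsto (fun t : ℝ => (∫⁻ s in Ioc 0 t, (g s : ℝ≥0∞)) / ENNReal.ofReal t)
      atTop (𝓝 (c : ℝ≥0∞))) (t : ℝ) : ∫⁻ s in Ioc 0 t, (g s : ℝ≥0∞) ≠ ⊤ := by
  -- An infinite integral up to `t` would make the quotient infinite at every later `t'`, against
  -- the finite limit.
  obtain ⟨t', h1, h2⟩ := ((hc.eventually_lt_const ENNReal.coe_lt_top).and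
    (eventually_ge_atTop t)).exists
  refine ne_top_of_le_ne_top (fun h => ?_) (lintegral_mono_set (Ioc_subset_Ioc_right h2))
  rw [h, ENNReal.top_div_of_ne_top ENNReal.ofReal_ne_top] at h1
  exact h1.ne rfl

lemma tendsto_setLIntegral_sub_div
    (hc : Tendsto (fun t : ℝ => (∫⁻ s in Ioc 0 t, (g s : ℝ≥0∞)) / ENNReal.ofReal t)
      atTop (𝓝 (c : ℝ≥0∞))) (T : ℝ) :
    Tendsto (fun t : ℝ => (∫⁻ s in Ioc 0 (t - T), (g s : ℝ≥0∞)) / ENNReal.ofReal t)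
      atTop (𝓝 (c : ℝ≥0∞)) := by
  have h1 : Tendsto (fun t : ℝ => t - T) atTop atTop := tendsto_atTop_add_const_right _ (-T) tendsto_id
  have h2 : Tendsto (fun t : ℝ => ENNReal.ofReal ((t - T) / t)) atTop (𝓝 1) := by
    rw [← ENNReal.ofReal_one]
    refine ENNReal.tendsto_ofReal ?_
    have : Tendsto (fun t : ℝ => 1 - T / t) atTop (𝓝 (1 - 0)) :=
      tendsto_const_nhds.sub (tendsto_const_nhds.div_atTop tendsto_id)
    rw [sub_zero] at this
    refine this.congr' ?_
    filter_upwards [eventually_gt_atTop 0] with t ht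
    field_simp
  have h3 := ENNReal.Tendsto.mul (hc.comp h1) (Or.inr ENNReal.one_ne_top) h2
    (Or.inr ENNReal.coe_ne_top)
  rw [mul_one] at h3
  refine h3.congr' ?_
  filter_upwards [eventually_gt_atTop 0, eventually_gt_atTop T] with t ht hT
  have hT' : 0 < t - T := sub_pos.2 hT
  rw [Function.comp_apply, ENNReal.ofReal_div_of_pos ht, mul_div_assoc', ENNReal.div_mul_cancel]
  · exact (ENNReal.ofReal_pos.2 hT').ne'
  · exact ENNReal.ofReal_ne_top

end

lemma tendsto_iSup_setLIntegral_div {γ : ℕ → ℝ → ℝ≥0} (hγ : ∀ n, Measurable (γ n))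
    (hγ1 : ∀ n, l1Norm (γ (n + 1)) ≠ ⊤) {γbar : ℝ≥0}
    (hγbar : Tendsto (fun t : ℝ => (∫⁻ s in Ioc 0 t, (γ 0 s : ℝ≥0∞)) / ENNReal.ofReal t)
      atTop (𝓝 (γbar : ℝ≥0∞))) (b : Bool) (a : ℝ≥0)
    (h : γbar ≠ 0 ∨ expIncrement b (⨆ M, totalExponent γ b a 0 M) ≠ ⊤) :
    Tendsto (fun t : ℝ => (⨆ M, ∫⁻ s in Ioc 0 t,
        (γ 0 s : ℝ≥0∞) * expIncrement b (clusterExponent γ b a 0 M (t - s))) / ENNReal.ofReal t)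
      atTop (𝓝 (γbar * expIncrement b (⨆ M, totalExponent γ b a 0 M))) := by
  have hg : Measurable fun s => (γ 0 s : ℝ≥0∞) := (hγ 0).coe_nnreal_ennreal
  have hmono : Monotone (totalExponent γ b a 0) :=
    monotone_nat_of_le_succ (totalExponent_le_succ γ b a 0)
  rw [tendsto_order]
  constructor
  · intro c hc
    have h1 : Tendsto (fun M => γbar * expIncrement b (totalExponent γ b a 0 M)) atTop
        (𝓝 (γbar * expIncrement b (⨆ M, totalExponent γ b a 0 M))) :=
      ENNReal.Tendsto.const_mul (((continuous_expIncrement b).tendsto _).comp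
        (tendsto_atTop_iSup hmono)) (Or.inr ENNReal.coe_ne_top)
    obtain ⟨M, hM⟩ := (h1.eventually_const_lt hc).exists
    have h2 : Tendsto (fun T => γbar * expIncrement b (clusterExponent γ b a 0 M T)) atTop
        (𝓝 (γbar * expIncrement b (totalExponent γ b a 0 M))) :=
      ENNReal.Tendsto.const_mul (((continuous_expIncrement b).tendsto _).comp
        (tendsto_clusterExponent b a hγ hγ1 0 M)) (Or.inr ENNReal.coe_ne_top)
    -- Immigrants arriving before `t - T` have age at least `T`, and their first `M` generations
    -- alone already push the average above `c`.
    obtain ⟨T, hT, hT0⟩ := ((h2.eventually_const_lt hM).and (eventually_ge_atTop 0)).exists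
    have h3 := ENNReal.Tendsto.mul_const (tendsto_setLIntegral_sub_div hγbar T)
      (b := expIncrement b (clusterExponent γ b a 0 M T))
      (Or.inr (expIncrement_ne_top b (ne_top_of_le_ne_top (totalExponent_ne_top b a hγ1 0 M)
        (clusterExponent_le_totalExponent γ b a hγ 0 M T))))
    filter_upwards [h3.eventually_const_lt hT] with t ht
    refine ht.trans_le ?_
    rw [← ENNReal.mul_div_right_comm]
    gcongr
    refine le_iSup_of_le M ?_
    rw [← lintegral_mul_const _ hg]
    refine (setLIntegral_mono' measurableSet_Ioc fun s hs => ?_).trans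
      (lintegral_mono_set (Ioc_subset_Ioc_right (sub_le_self t hT0)))
    gcongr
    exact monotone_expIncrement b (monotone_clusterExponent γ b a 0 M (by linarith [hs.2]))
  · intro c hc
    -- The hypothesis `h` excludes the indeterminate product `0 · ∞`.
    have h1 := ENNReal.Tendsto.mul_const hγbar
      (b := expIncrement b (⨆ M, totalExponent γ b a 0 M)) (by simpa using h)
    filter_upwards [h1.eventually_lt_const hc] with t ht
    refine lt_of_le_of_lt ?_ ht
    rw [← ENNReal.mul_div_right_comm]
    gcongr
    refine iSup_le fun M => ?_
    rw [← lintegral_mul_const _ hg]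
    refine lintegral_mono fun s => ?_
    gcongr
    exact monotone_expIncrement b ((clusterExponent_le_totalExponent γ b a hγ 0 M _).trans
      (le_iSup _ M))

/-! ### The limit theorem. -/

lemma l1Norm_ne_top_of_offspringMean_lt_one {γ : ℕ → ℝ → ℝ≥0} (hρ : offspringMean γ < 1) (n : ℕ) :
    l1Norm (γ (n + 1)) ≠ ⊤ :=
  ((le_iSup₂_of_le (f := fun (n : ℕ) (_ : 1 ≤ n) => l1Norm (γ n)) (n + 1)
    (Nat.le_add_left 1 n) le_rfl).trans_lt (hρ.trans ENNReal.one_lt_top)).ne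

lemma expIncrement_ne_top_of_signedCoe_ne_top (b : Bool) {x : ℝ≥0∞} (h : signedCoe b x ≠ ⊤) :
    expIncrement b x ≠ ⊤ := by
  cases b
  · exact ne_top_of_le_ne_top ENNReal.one_ne_top (expIncrement_false_le_one x)
  · exact expIncrement_ne_top true (by simpa [signedCoe] using h)

theorem mainTheorem2 {Ω : Type*} [MeasurableSpace Ω] (μ : Measure Ω) [IsProbabilityMeasure μ]
    (γ : ℕ → ℝ → ℝ≥0) (hγ : ∀ n, Measurable (γ n))
    (N : ℕ → Ω → Measure ℝ) (hN : IsHawkesGenerations μ γ N)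
    (γbar : ℝ≥0)
    (hγbar : Tendsto (fun t : ℝ => (∫⁻ s in Ioc 0 t, (γ 0 s : ℝ≥0∞)) / ENNReal.ofReal t)
      atTop (𝓝 (γbar : ℝ≥0∞)))
    (hρ : offspringMean γ < 1) :
    ∃ fInf Γ : ℝ → EReal, ∀ θ : ℝ,
      Tendsto (fun M : ℕ => (hawkesF γ θ M M : EReal)) atTop (𝓝 (fInf θ)) ∧
      ((γbar ≠ 0 ∨ fInf θ ≠ ⊤) →
        Tendsto (fun t : ℝ => ((1 / t : ℝ) : EReal) *
            ENNReal.log (∫⁻ ω, EReal.exp ((θ : EReal) * (hawkesCount N t ω : EReal)) ∂μ))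
          atTop (𝓝 (Γ θ)) ∧
        Γ θ = ((γbar : ℝ) : EReal) * ((EReal.exp (fInf θ) : EReal) - 1)) := by
  have hγ1 := l1Norm_ne_top_of_offspringMean_lt_one hρ
  have h0 := setLIntegral_Ioc_ne_top_of_tendsto_div hγbar
  suffices H : ∀ θ : ℝ, ∃ f G : EReal,
      Tendsto (fun M : ℕ => (hawkesF γ θ M M : EReal)) atTop (𝓝 f) ∧
      ((γbar ≠ 0 ∨ f ≠ ⊤) →
        Tendsto (fun t : ℝ => ((1 / t : ℝ) : EReal) *
            ENNReal.log (∫⁻ ω, EReal.exp ((θ : EReal) * (hawkesCount N t ω : EReal)) ∂μ))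
          atTop (𝓝 G) ∧
        G = ((γbar : ℝ) : EReal) * ((EReal.exp f : EReal) - 1)) by
    choose f G h using H
    exact ⟨f, G, h⟩
  intro θ
  obtain ⟨b, a, rfl⟩ : ∃ (b : Bool) (a : ℝ≥0), θ = boolSign b * a := by
    rcases le_total 0 θ with h | h
    · exact ⟨true, NNReal.mk θ h, (one_mul θ).symm⟩
    · exact ⟨false, NNReal.mk (-θ) (neg_nonneg.2 h), by rw [boolSign, NNReal.coe_mk]; ring⟩
  set φ := ⨆ M, totalExponent γ b a 0 M
  refine ⟨signedCoe b φ, signedCoe b (γbar * expIncrement b φ), ?_, fun h => ⟨?_, ?_⟩⟩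
  · simp_rw [coe_hawkesF hγ1]
    exact ((continuous_signedCoe b).tendsto _).comp
      (tendsto_atTop_iSup (monotone_nat_of_le_succ (totalExponent_le_succ γ b a 0)))
  · have h1 := tendsto_iSup_setLIntegral_div hγ hγ1 hγbar b a
      (h.imp_right (expIncrement_ne_top_of_signedCoe_ne_top b))
    refine (((continuous_signedCoe b).tendsto _).comp h1).congr' ?_
    filter_upwards [eventually_gt_atTop 0] with t ht
    simp_rw [boolSign_mul_signedCoe b a.coe_nonneg, ← signedExp_eq_exp]
    have h2 := lintegral_signedExp_hawkesCount hγ hN h0 hγ1 b a t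
    rw [← ENNReal.ofReal_coe_nnreal] at h2
    rw [h2, signedExp_eq_exp, EReal.log_exp, coe_mul_signedCoe b (by positivity),
      Function.comp_apply, one_div, ENNReal.ofReal_inv_of_pos ht, mul_comm, ENNReal.div_eq_inv_mul,
      mul_comm]
  · rw [← signedCoe_expIncrement, coe_mul_signedCoe b γbar.coe_nonneg, ENNReal.ofReal_coe_nnreal]
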